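/- Let $n=p_1+\dots+p_N$ and $m=m_1+\dots+m_N$, and write $x=(x_1,\dots,x_N)\in\mathbb{R}^n$ with $x_i\in\mathbb{R}^{p_i}$. Let $\mathcal{C}$ be the set of measurable functions $\mu:\mathbb{R}^n\to\mathbb{R}^m$ of the form $\mu(x)=(\mu_1(x_1),\dots,\mu_N(x_N))$ with $\mu_i:\mathbb{R}^{p_i}\to\mathbb{R}^{m_i}$, and let $\mathbb{K}$ be the set of block-diagonal matrices $K=\mathrm{diag}(K_1,\dots,K_N)$ with $K_i\in\mathbb{R}^{m_i\times p_i}$. Let $x\sim\mathcal{N}(0,X)$ be a zero-mean Gaussian vector in $\mathbb{R}^n$ with given (possibly singular) covariance matrix $X$. Let $\begin{bmatrix}Q_0&S_0\\S_0^T&R_0\end{bmatrix}$ be symmetric positive semidefinite of size $(n+m)\times(n+m)$ with $R_0\in\mathbb{R}^{m\times m}$ positive definite; for $j=1,\dots,M$ let $\begin{bmatrix}Q_j&S_j\\S_j^T&R_j\end{bmatrix}$ be symmetric of the same size with $R_j\in\mathbb{R}^{m\times m}$ positive semidefinite, and let $\gamma_j\in\mathbb{R}$. For $\mu\in\mathcal{C}$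 and $j=0,\dots,M$ put $$J_j(\mu)=\mathbf{E}\begin{bmatrix}x\\\mu(x)\end{bmatrix}^T\begin{bmatrix}Q_j&S_j\\S_j^T&R_j\end{bmatrix}\begin{bmatrix}x\\\mu(x)\end{bmatrix},$$ and consider the problem of minimizing $J_0(\mu)$ over $\mu\in\mathcal{C}$ subject to $J_j(\mu)\le\gamma_j$ for $j=1,\dots,M$. Call $\mu\in\mathcal{C}$ feasible if the expectations $J_0(\mu),\dots,J_M(\mu)$ exist and are finite and $J_j(\mu)\le\gamma_j$ for $j=1,\dots,M$. If a feasible $\mu\in\mathcal{C}$ exists, then there is a matrix $K=K(X)\in\mathbb{K}$ such that the linear decision $x\mapsto Kx$ is optimal: it is feasible, and $J_0(Kx)\le J_0(\mu)$ for every feasible $\mu\in\mathcal{C}$, linear or nonlinear. -/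

import Mathlib

open MeasureTheory ProbabilityTheory
open scoped Matrix

noncomputable section

namespace TeamLQG

/-- Index set of a vector in `ℝ^{d₁ + ⋯ + d_N}` partitioned into `N` blocks of sizes `d i`. -/
abbrev BlockIdx {N : ℕ} (d : Fin N → ℕ) : Type := (i : Fin N) × Fin (d i)

/-- The quadratic form `[x; u]ᵀ [Q S; Sᵀ R] [x; u]`. -/
def quadForm {ι κ : Type*} [Fintype ι] [Fintype κ]
    (Q : Matrix ι ι ℝ) (S : Matrix ι κ ℝ) (R : Matrix κ κ ℝ) (x : ι → ℝ) (u : κ → ℝ) : ℝ :=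
  Sum.elim x u ⬝ᵥ (Matrix.fromBlocks Q S Sᵀ R *ᵥ Sum.elim x u)

variable {N M : ℕ} {p m : Fin N → ℕ}

/-- The measurable structured (team) decisions
`μ(x) = (μ₁(x₁), …, μ_N(x_N))` with `μ_i : ℝ^{p_i} → ℝ^{m_i}`. -/
def IsTeamDecision (μ : (BlockIdx p → ℝ) → (BlockIdx m → ℝ)) : Prop :=
  ∃ f : (i : Fin N) → (Fin (p i) → ℝ) → (Fin (m i) → ℝ),
    (∀ i, Measurable (f i)) ∧
      ∀ (x : BlockIdx p → ℝ) (i : Fin N) (a : Fin (m i)), μ x ⟨i, a⟩ = f i (fun b => x ⟨i, b⟩) a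

/-- The set of structured gain matrices `K = diag(K₁, …, K_N)`, `K_i ∈ ℝ^{m_i × p_i}`. -/
def teamGains (m p : Fin N → ℕ) : Set (Matrix (BlockIdx m) (BlockIdx p) ℝ) :=
  Set.range fun k : (i : Fin N) → Matrix (Fin (m i)) (Fin (p i)) ℝ => Matrix.blockDiagonal' k

/-- The random variable `[x; μ(x)]ᵀ [Q S; Sᵀ R] [x; μ(x)]`, as a function of `x`. -/
def stageCost (Q : Matrix (BlockIdx p) (BlockIdx p) ℝ) (S : Matrix (BlockIdx p) (BlockIdx m) ℝ)
    (R : Matrix (BlockIdx m) (BlockIdx m) ℝ) (μ : (BlockIdx p → ℝ) → (BlockIdx m → ℝ))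
    (x : EuclideanSpace ℝ (BlockIdx p)) : ℝ :=
  quadForm Q S R (fun b => x b) (μ fun b => x b)

/-- The expectation `E [x; μ(x)]ᵀ [Q S; Sᵀ R] [x; μ(x)]` for `x ∼ 𝒩(0, X)`. -/
def expCost (X : Matrix (BlockIdx p) (BlockIdx p) ℝ)
    (Q : Matrix (BlockIdx p) (BlockIdx p) ℝ) (S : Matrix (BlockIdx p) (BlockIdx m) ℝ)
    (R : Matrix (BlockIdx m) (BlockIdx m) ℝ) (μ : (BlockIdx p → ℝ) → (BlockIdx m → ℝ)) : ℝ :=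
  ∫ x, stageCost Q S R μ x ∂(multivariateGaussian 0 X)

/-- The expectation `E [x; μ(x)]ᵀ [Q S; Sᵀ R] [x; μ(x)]` for `x ∼ 𝒩(0, X)` exists and is finite. -/
def HasExpCost (X : Matrix (BlockIdx p) (BlockIdx p) ℝ)
    (Q : Matrix (BlockIdx p) (BlockIdx p) ℝ) (S : Matrix (BlockIdx p) (BlockIdx m) ℝ)
    (R : Matrix (BlockIdx m) (BlockIdx m) ℝ) (μ : (BlockIdx p → ℝ) → (BlockIdx m → ℝ)) : Prop :=
  Integrable (stageCost Q S R μ) (multivariateGaussian 0 X)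

/-- The data of a constrained team problem: the weights of the objective, and for each `j` the
weights and the bound `γ j` of the `j`-th constraint. -/
structure Problem (M : ℕ) (p m : Fin N → ℕ) where
  /-- objective, state weight -/
  Q₀ : Matrix (BlockIdx p) (BlockIdx p) ℝ
  /-- objective, cross weight -/
  S₀ : Matrix (BlockIdx p) (BlockIdx m) ℝ
  /-- objective, decision weight -/
  R₀ : Matrix (BlockIdx m) (BlockIdx m) ℝ
  /-- constraints, state weights -/
  Q : Fin M → Matrix (BlockIdx p) (BlockIdx p) ℝ
  /-- constraints, cross weights -/
  S : Fin M → Matrix (BlockIdx p) (BlockIdx m) ℝ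
  /-- constraints, decision weights -/
  R : Fin M → Matrix (BlockIdx m) (BlockIdx m) ℝ
  /-- constraint bounds -/
  γ : Fin M → ℝ

/-- `μ` is a feasible decision: a measurable team decision of finite expected cost whose
constraint expectations exist and satisfy the bounds. -/
structure IsFeasible (D : Problem M p m) (X : Matrix (BlockIdx p) (BlockIdx p) ℝ)
    (μ : (BlockIdx p → ℝ) → (BlockIdx m → ℝ)) : Prop where
  team : IsTeamDecision μ
  finite_cost : HasExpCost X D.Q₀ D.S₀ D.R₀ μ
  finite_constraint : ∀ j, HasExpCost X (D.Q j) (D.S j) (D.R j) μ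
  constraint_le : ∀ j, expCost X (D.Q j) (D.S j) (D.R j) μ ≤ D.γ j

/-- `μ` attains the minimum of the objective over all feasible decisions, linear or not. -/
structure IsOptimal (D : Problem M p m) (X : Matrix (BlockIdx p) (BlockIdx p) ℝ)
    (μ : (BlockIdx p → ℝ) → (BlockIdx m → ℝ)) : Prop where
  feasible : IsFeasible D X μ
  cost_le : ∀ ν, IsFeasible D X ν →
    expCost X D.Q₀ D.S₀ D.R₀ μ ≤ expCost X D.Q₀ D.S₀ D.R₀ ν

end TeamLQG

end

/-! Replace each `μ_i(x_i)` by its best linear predictor `K_i x_i` in `L²`. The error is a function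
of `x_i` orthogonal to the coordinates of `x_i`. It is in fact orthogonal to every coordinate of
`x`: by Gaussianity such a coordinate is a linear function of `x_i` plus a centered residual
independent of `x_i` (`exists_linear_predictor`). So the cross terms with `x` do not change, and
each `J_j` drops by the `R_j`-form of the error, which is nonnegative (`gramCost_le_of_orthogonal`).
One block-diagonal `K` thus improves the objective and all constraints at once. Square integrability
of `μ`, needed to project, follows from finite `J_0` and `R₀ > 0`.

What remains is a finite-dimensional problem over linear decisions, with closed constraint set and
coercive objective (`exists_isMinOn_gramCost`).

Costs are written as `gramCost` in an inner product space, so the same estimates serve pointwise in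
`ℝ` and for random variables in `L²`. -/

namespace TeamLQG

/-! ### Quadratic costs in an inner product space. -/

section Hilbert

open scoped RealInnerProductSpace

variable {H β κ : Type*} [NormedAddCommGroup H] [InnerProductSpace ℝ H] [Fintype β] [Fintype κ]

/-- The quadratic cost with weights `Q`, `S`, `R` of a decision family `U` given the observation
family `ξ`, both in an inner product space. -/
noncomputable def gramCost (Q : Matrix β β ℝ) (S : Matrix β κ ℝ) (R : Matrix κ κ ℝ)
    (ξ : β → H) (U : κ → H) : ℝ :=
  (∑ b, ∑ b', Q b b' * ⟪ξ b, ξ b'⟫) + 2 * (∑ b, ∑ c, S b c * ⟪ξ b, U c⟫)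
    + ∑ c, ∑ c', R c c' * ⟪U c, U c'⟫

/-- Factoring `R = Aᴴ A` turns the double sum into a sum of squared norms of the combinations `∑ c,
A d c • D c`. -/
theorem sum_mul_inner_nonneg {R : Matrix κ κ ℝ} (hR : R.PosSemidef) (D : κ → H) :
    0 ≤ ∑ c, ∑ c', R c c' * ⟪D c, D c'⟫ := by
  classical
  obtain ⟨A, rfl⟩ : ∃ A : Matrix κ κ ℝ, R = Aᴴ * A := by
    open scoped MatrixOrder in
    exact CStarAlgebra.nonneg_iff_eq_star_mul_self.1 hR.nonneg
  have : ∑ c, ∑ c', (Aᴴ * A) c c' * ⟪D c, D c'⟫ = ∑ d, ⟪∑ c, A d c • D c, ∑ c, A d c • D c⟫ := by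
    simp only [Matrix.mul_apply, sum_inner, inner_sum, real_inner_smul_left, real_inner_smul_right,
      Finset.sum_mul, Matrix.conjTranspose_apply, star_trivial]
    rw [Finset.sum_comm' (t' := Finset.univ) (s' := fun _ => Finset.univ) (by simp)]
    rw [Finset.sum_comm]
    conv_lhs => enter [2, c]; rw [Finset.sum_comm]
    rw [Finset.sum_comm]
    refine Finset.sum_congr rfl fun d _ => Finset.sum_congr rfl fun c _ =>
      Finset.sum_congr rfl fun c' _ => ?_
    rw [real_inner_comm]
    ring
  rw [this]
  exact Finset.sum_nonneg fun d _ => real_inner_self_nonneg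

/-- Pythagoras: the error `U - V` is orthogonal to `ξ`, hence also to `V`, which lies in its span.
The terms in `Q` and `S` agree, and the `R`-terms differ by the form of `U - V`. -/
theorem gramCost_le_of_orthogonal {Q : Matrix β β ℝ} {S : Matrix β κ ℝ} {R : Matrix κ κ ℝ}
    (hR : R.PosSemidef) {ξ : β → H} {U V : κ → H} (hξ : ∀ b c, ⟪ξ b, U c - V c⟫ = 0)
    (hV : ∀ c, V c ∈ Submodule.span ℝ (Set.range ξ)) :
    gramCost Q S R ξ V ≤ gramCost Q S R ξ U := by
  have hVD : ∀ c c', ⟪V c, U c' - V c'⟫ = 0 := fun c c' => by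
    refine Submodule.span_induction (p := fun v _ => ⟪v, U c' - V c'⟫ = 0) ?_ ?_ ?_ ?_ (hV c)
    · rintro _ ⟨b, rfl⟩
      exact hξ b c'
    · exact inner_zero_left _
    · intro x y _ _ hx hy
      rw [inner_add_left, hx, hy, add_zero]
    · intro a x _ hx
      rw [real_inner_smul_left, hx, mul_zero]
  have h1 : ∀ b c, ⟪ξ b, U c⟫ = ⟪ξ b, V c⟫ := fun b c => by
    have := hξ b c
    rw [inner_sub_right] at this
    linarith
  have h2 : ∀ c c', ⟪U c, U c'⟫ = ⟪V c, V c'⟫ + ⟪U c - V c, U c' - V c'⟫ := fun c c' => by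
    have e1 := hVD c c'
    have e2 := hVD c' c
    rw [inner_sub_right] at e1 e2
    rw [inner_sub_left, inner_sub_right, inner_sub_right, real_inner_comm (V c') (U c)]
    rw [real_inner_comm (V c) (V c')] at e2
    linarith
  have h3 := sum_mul_inner_nonneg hR fun c => U c - V c
  simp only [gramCost, h1, h2, mul_add, Finset.sum_add_distrib]
  linarith

theorem exists_pos_posSemidef_sub_smul_one [DecidableEq κ] {R : Matrix κ κ ℝ} (hR : R.PosDef) :
    ∃ r : ℝ, 0 < r ∧ (R - r • (1 : Matrix κ κ ℝ)).PosSemidef := by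
  rcases isEmpty_or_nonempty κ with hκ | hκ
  · exact ⟨1, one_pos, by rw [Subsingleton.elim (R - _) 0]; exact Matrix.PosSemidef.zero⟩
  open scoped MatrixOrder in
  obtain ⟨r, hr, h⟩ := (CFC.exists_pos_algebraMap_le_iff (A := Matrix κ κ ℝ) (a := R)
    hR.isHermitian.isSelfAdjoint).2 fun x hx => hR.isStrictlyPositive.spectrum_pos hx
  exact ⟨r, hr, by rw [← Algebra.algebraMap_eq_smul_one]; exact Matrix.le_iff.1 h⟩

/-- Strong convexity in the decision bounds the decision by the cost. -/
theorem sum_norm_sq_le_gramCost [DecidableEq κ] (Q : Matrix β β ℝ) (S : Matrix β κ ℝ)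
    {R : Matrix κ κ ℝ} {r : ℝ} (hr : 0 < r) (hR : (R - r • (1 : Matrix κ κ ℝ)).PosSemidef)
    (ξ : β → H) (U : κ → H) :
    r / 2 * ∑ c, ‖U c‖ ^ 2 ≤ gramCost Q S R ξ U - (∑ b, ∑ b', Q b b' * ⟪ξ b, ξ b'⟫)
      + 2 / r * ∑ c, ‖∑ b, S b c • ξ b‖ ^ 2 := by
  have h1 := sum_mul_inner_nonneg hR U
  have h2 : ∑ c, ∑ c', (R - r • (1 : Matrix κ κ ℝ)) c c' * ⟪U c, U c'⟫
      = (∑ c, ∑ c', R c c' * ⟪U c, U c'⟫) - r * ∑ c, ‖U c‖ ^ 2 := by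
    simp [sub_mul, Finset.sum_sub_distrib, Matrix.one_apply, Finset.mul_sum]
  have h3 : ∑ b, ∑ c, S b c * ⟪ξ b, U c⟫ = ∑ c, ⟪∑ b, S b c • ξ b, U c⟫ := by
    rw [Finset.sum_comm]
    simp [sum_inner, real_inner_smul_left]
  -- Completing the square: half of the convexity `r` absorbs the cross term, and the other half
  -- remains as the bound on `U`.
  have h4 : 0 ≤ ∑ c, ‖(2 / r) • (∑ b, S b c • ξ b) + U c‖ ^ 2 :=
    Finset.sum_nonneg fun c _ => sq_nonneg _
  have h5 : r / 2 * ∑ c, ‖(2 / r) • (∑ b, S b c • ξ b) + U c‖ ^ 2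
      = 2 / r * (∑ c, ‖∑ b, S b c • ξ b‖ ^ 2) + 2 * (∑ c, ⟪∑ b, S b c • ξ b, U c⟫)
        + r / 2 * ∑ c, ‖U c‖ ^ 2 := by
    simp only [Finset.mul_sum, ← Finset.sum_add_distrib]
    refine Finset.sum_congr rfl fun c _ => ?_
    rw [norm_add_sq_real, norm_smul, real_inner_smul_left, Real.norm_of_nonneg (by positivity)]
    field_simp
  have h6 := mul_nonneg (half_pos hr).le h4
  rw [h2] at h1
  rw [h5] at h6
  rw [gramCost, h3]
  linarith

theorem continuous_gramCost (Q : Matrix β β ℝ) (S : Matrix β κ ℝ) (R : Matrix κ κ ℝ) (ξ : β → H) :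
    Continuous (gramCost Q S R ξ) := by
  unfold gramCost
  fun_prop

/-- On a finite-dimensional space of decisions, the constrained quadratic problem with positive
definite objective weight is solvable as soon as it is feasible. -/
theorem exists_isMinOn_gramCost {M : ℕ} {R₀ : Matrix κ κ ℝ} (hR₀ : R₀.PosDef)
    (Q₀ : Matrix β β ℝ) (S₀ : Matrix β κ ℝ) (Q : Fin M → Matrix β β ℝ) (S : Fin M → Matrix β κ ℝ)
    (R : Fin M → Matrix κ κ ℝ) (γ : Fin M → ℝ) (ξ : β → H)
    (W : Submodule ℝ (κ → H)) [FiniteDimensional ℝ W]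
    (hW : ∃ w ∈ W, ∀ j, gramCost (Q j) (S j) (R j) ξ w ≤ γ j) :
    ∃ w ∈ W, (∀ j, gramCost (Q j) (S j) (R j) ξ w ≤ γ j) ∧
      ∀ v ∈ W, (∀ j, gramCost (Q j) (S j) (R j) ξ v ≤ γ j) →
        gramCost Q₀ S₀ R₀ ξ w ≤ gramCost Q₀ S₀ R₀ ξ v := by
  classical
  obtain ⟨w₀, hw₀, hw₀'⟩ := hW
  obtain ⟨r, hr, hR⟩ := exists_pos_posSemidef_sub_smul_one hR₀
  have : ProperSpace W := FiniteDimensional.proper ℝ W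
  have hc : ∀ (Q : Matrix β β ℝ) (S : Matrix β κ ℝ) (R : Matrix κ κ ℝ),
      Continuous fun w : W => gramCost Q S R ξ w := fun Q S R =>
    (continuous_gramCost Q S R ξ).comp continuous_subtype_val
  set s : Set W := {w | ∀ j, gramCost (Q j) (S j) (R j) ξ w ≤ γ j} with hs
  have hsc : IsClosed s := by
    rw [hs, Set.ofPred_forall]
    exact isClosed_iInter fun j => isClosed_le (hc _ _ _) continuous_const
  have hlow : ∀ w : W, r / 2 * ‖w‖ ^ 2 ≤ gramCost Q₀ S₀ R₀ ξ w
      - (∑ b, ∑ b', Q₀ b b' * ⟪ξ b, ξ b'⟫) + 2 / r * ∑ c, ‖∑ b, S₀ b c • ξ b‖ ^ 2 := fun w => by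
    refine le_trans ?_ (sum_norm_sq_le_gramCost Q₀ S₀ hr hR ξ w)
    gcongr
    -- `κ → H` carries the supremum norm, which is at most the Euclidean one.
    rw [← Real.sqrt_le_sqrt_iff (Finset.sum_nonneg fun c _ => sq_nonneg _),
      Real.sqrt_sq (norm_nonneg _)]
    refine (pi_norm_le_iff_of_nonneg (Real.sqrt_nonneg _)).2 fun c => Real.le_sqrt_of_sq_le ?_
    exact Finset.single_le_sum (f := fun c => ‖(w : κ → H) c‖ ^ 2)
      (fun c _ => sq_nonneg _) (Finset.mem_univ c)
  have htop : Filter.Tendsto (fun w : W => gramCost Q₀ S₀ R₀ ξ w) (Filter.cocompact W)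
      Filter.atTop := by
    have h1 : Filter.Tendsto (fun w : W => r / 2 * ‖w‖ ^ 2
        + ((∑ b, ∑ b', Q₀ b b' * ⟪ξ b, ξ b'⟫) - 2 / r * ∑ c, ‖∑ b, S₀ b c • ξ b‖ ^ 2))
        (Filter.cocompact W) Filter.atTop :=
      Filter.tendsto_atTop_add_const_right _ _ (((Filter.tendsto_pow_atTop two_ne_zero).comp
        (tendsto_norm_cocompact_atTop (E := W))).const_mul_atTop (half_pos hr))
    refine Filter.tendsto_atTop_mono (fun w => ?_) h1
    linarith [hlow w]
  obtain ⟨w, hws, hw⟩ := (hc Q₀ S₀ R₀).continuousOn.exists_isMinOn' (s := s) hsc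
    (x₀ := ⟨w₀, hw₀⟩) hw₀' (Filter.Eventually.filter_mono inf_le_left
      (htop.eventually_ge_atTop _))
  exact ⟨w, w.2, hws, fun v hv hv' => hw (a := ⟨v, hv⟩) hv'⟩

/-- Least squares: every vector has a best linear predictor in terms of a finite family. -/
theorem exists_inner_sub_sum_smul_eq_zero {ι : Type*} [Fintype ι] (ξ : ι → H) (y : H) :
    ∃ w : ι → ℝ, ∀ l, ⟪ξ l, y - ∑ j, w j • ξ j⟫ = 0 := by
  have := FiniteDimensional.span_of_finite ℝ (Set.finite_range ξ)
  obtain ⟨w, hw⟩ := (Submodule.mem_span_range_iff_exists_fun ℝ).1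
    (Submodule.starProjection_apply_mem (Submodule.span ℝ (Set.range ξ)) y)
  refine ⟨w, fun l => ?_⟩
  rw [hw, real_inner_comm]
  exact Submodule.starProjection_inner_eq_zero _ _ (Submodule.subset_span ⟨l, rfl⟩)

end Hilbert

/-! ### Expected costs as quadratic costs in `L²`. -/

section SquareIntegrable

open scoped RealInnerProductSpace

variable {Ω β κ ι : Type*} [MeasurableSpace Ω] {P : Measure Ω} [Fintype β] [Fintype κ] [Fintype ι]

theorem inner_toLp_toLp {f g : Ω → ℝ} (hf : MemLp f 2 P) (hg : MemLp g 2 P) :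
    ⟪hf.toLp f, hg.toLp g⟫ = ∫ ω, f ω * g ω ∂P := by
  rw [L2.inner_def]
  refine integral_congr_ae ?_
  filter_upwards [hf.coeFn_toLp, hg.coeFn_toLp] with ω h1 h2
  rw [h1, h2, RCLike.inner_apply, conj_trivial, mul_comm]

theorem toLp_sum_mul {f : ι → Ω → ℝ} (hf : ∀ j, MemLp (f j) 2 P) (a : ι → ℝ) {g : Ω → ℝ}
    (hg : MemLp g 2 P) (h : ∀ ω, g ω = ∑ j, a j * f j ω) :
    hg.toLp g = ∑ j, a j • (hf j).toLp (f j) := by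
  refine Lp.ext (hg.coeFn_toLp.trans ?_)
  refine Filter.EventuallyEq.trans ?_ (Lp.coeFn_finsetSum _ _).symm
  have h1 : ∀ j, (a j • (hf j).toLp (f j) : Lp ℝ 2 P) =ᵐ[P] fun ω => a j * f j ω := fun j => by
    filter_upwards [Lp.coeFn_smul (a j) ((hf j).toLp (f j)), (hf j).coeFn_toLp] with ω e1 e2
    rw [e1, Pi.smul_apply, e2, smul_eq_mul]
  filter_upwards [ae_all_iff.2 h1] with ω hω
  rw [h, Finset.sum_apply]
  exact Finset.sum_congr rfl fun j _ => (hω j).symm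

theorem integral_sum_mul_inner (A : Matrix β κ ℝ) {g : β → Ω → ℝ} {h : κ → Ω → ℝ}
    (hg : ∀ b, MemLp (g b) 2 P) (hh : ∀ c, MemLp (h c) 2 P) :
    Integrable (fun ω => ∑ b, ∑ c, A b c * ⟪g b ω, h c ω⟫) P ∧
      ∫ ω, ∑ b, ∑ c, A b c * ⟪g b ω, h c ω⟫ ∂P
        = ∑ b, ∑ c, A b c * ⟪(hg b).toLp (g b), (hh c).toLp (h c)⟫ := by
  have hi : ∀ b c, Integrable (fun ω => A b c * ⟪g b ω, h c ω⟫) P := fun b c => by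
    simp only [RCLike.inner_apply, conj_trivial]
    exact ((hh c).integrable_mul (hg b)).const_mul _
  refine ⟨integrable_finsetSum _ fun b _ => integrable_finsetSum _ fun c _ => hi b c, ?_⟩
  rw [integral_finsetSum _ fun b _ => integrable_finsetSum _ fun c _ => hi b c]
  refine Finset.sum_congr rfl fun b _ => ?_
  rw [integral_finsetSum _ fun c _ => hi b c]
  refine Finset.sum_congr rfl fun c _ => ?_
  rw [integral_const_mul, inner_toLp_toLp]
  simp only [RCLike.inner_apply, conj_trivial, mul_comm]

theorem integrable_gramCost (Q : Matrix β β ℝ) (S : Matrix β κ ℝ) (R : Matrix κ κ ℝ)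
    {f : β → Ω → ℝ} {u : κ → Ω → ℝ} (hf : ∀ b, MemLp (f b) 2 P) (hu : ∀ c, MemLp (u c) 2 P) :
    Integrable (fun ω => gramCost Q S R (fun b => f b ω) (fun c => u c ω)) P :=
  ((integral_sum_mul_inner Q hf hf).1.add ((integral_sum_mul_inner S hf hu).1.const_mul 2)).add
    (integral_sum_mul_inner R hu hu).1

theorem integral_gramCost (Q : Matrix β β ℝ) (S : Matrix β κ ℝ) (R : Matrix κ κ ℝ)
    {f : β → Ω → ℝ} {u : κ → Ω → ℝ} (hf : ∀ b, MemLp (f b) 2 P) (hu : ∀ c, MemLp (u c) 2 P) :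
    ∫ ω, gramCost Q S R (fun b => f b ω) (fun c => u c ω) ∂P
      = gramCost Q S R (fun b => (hf b).toLp (f b)) (fun c => (hu c).toLp (u c)) := by
  obtain ⟨i1, e1⟩ := integral_sum_mul_inner Q hf hf
  obtain ⟨i2, e2⟩ := integral_sum_mul_inner S hf hu
  obtain ⟨i3, e3⟩ := integral_sum_mul_inner R hu hu
  have h := integral_add (i1.add (i2.const_mul 2)) i3
  rw [integral_add' i1 (i2.const_mul 2), integral_const_mul, e1, e2, e3] at h
  exact h

/-- The strong convexity bound, applied pointwise with `H = ℝ`, dominates `‖u c‖ ^ 2` by integrable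
functions. -/
theorem memLp_two_of_integrable_gramCost {Q : Matrix β β ℝ} {S : Matrix β κ ℝ} {R : Matrix κ κ ℝ}
    (hR : R.PosDef) {f : β → Ω → ℝ} {u : κ → Ω → ℝ} (hf : ∀ b, MemLp (f b) 2 P)
    (hu : ∀ c, AEStronglyMeasurable (u c) P)
    (h : Integrable (fun ω => gramCost Q S R (fun b => f b ω) (fun c => u c ω)) P) (c : κ) :
    MemLp (u c) 2 P := by
  classical
  obtain ⟨r, hr, hR'⟩ := exists_pos_posSemidef_sub_smul_one hR
  have hQ := (integral_sum_mul_inner Q hf hf).1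
  have hS : Integrable (fun ω => ∑ c, ‖∑ b, S b c • f b ω‖ ^ 2) P :=
    integrable_finsetSum _ fun c _ =>
      (memLp_finsetSum _ fun b _ => (hf b).const_smul (S b c)).integrable_norm_pow two_ne_zero
  refine (memLp_two_iff_integrable_sq_norm (hu c)).2 ?_
  refine (((h.sub hQ).add (hS.const_mul (2 / r))).const_mul (2 / r)).mono'
    ((hu c).norm.pow 2) (Filter.Eventually.of_forall fun ω => ?_)
  have h1 := sum_norm_sq_le_gramCost Q S hr hR' (fun b => f b ω) (fun c => u c ω)
  have h2 : ‖u c ω‖ ^ 2 ≤ ∑ c, ‖u c ω‖ ^ 2 :=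
    Finset.single_le_sum (f := fun c => ‖u c ω‖ ^ 2) (fun c _ => sq_nonneg _) (Finset.mem_univ c)
  rw [Real.norm_of_nonneg (by positivity)]
  simp only [Pi.add_apply, Pi.sub_apply]
  calc ‖u c ω‖ ^ 2 ≤ 2 / r * (r / 2 * ∑ c, ‖u c ω‖ ^ 2) := by
        rw [← mul_assoc, div_mul_div_cancel₀ hr.ne', div_self two_ne_zero, one_mul]
        exact h2
    _ ≤ _ := by gcongr

end SquareIntegrable

/-! ### Linear prediction from Gaussian observations. -/

section Gaussian

open scoped RealInnerProductSpace

variable {Ω β ι : Type*} [MeasurableSpace Ω] {P : Measure Ω} [Fintype β] [Fintype ι]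

/-- For a centered Gaussian vector `Z`, the error of the best linear predictor of `U (Z ∘ e)` in
terms of `Z ∘ e` is orthogonal to every coordinate of `Z`. -/
theorem exists_linear_predictor {Z : β → Ω → ℝ} (hG : HasGaussianLaw (fun ω b => Z b ω) P)
    (hZ : ∀ b, MemLp (Z b) 2 P) (hZ0 : ∀ b, ∫ ω, Z b ω ∂P = 0) (e : ι → β)
    {U : (ι → ℝ) → ℝ} (hU : Measurable U) (hU2 : MemLp (fun ω => U fun j => Z (e j) ω) 2 P) :
    ∃ w : ι → ℝ, ∀ b, ⟪(hZ b).toLp (Z b),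
      hU2.toLp _ - ∑ j, w j • (hZ (e j)).toLp (Z (e j))⟫ = 0 := by
  have := hG.isProbabilityMeasure
  obtain ⟨w, hw⟩ := exists_inner_sub_sum_smul_eq_zero
    (fun j => (hZ (e j)).toLp (Z (e j))) (hU2.toLp _)
  refine ⟨w, fun b => ?_⟩
  -- Regress `Z b` on the observations `Z ∘ e`. Projection in `L²` needs no invertible covariance.
  obtain ⟨a, ha⟩ := exists_inner_sub_sum_smul_eq_zero
    (fun j => (hZ (e j)).toLp (Z (e j))) ((hZ b).toLp (Z b))
  have hsum : ∀ v : ι → ℝ, MemLp (fun ω => ∑ j, v j * Z (e j) ω) 2 P := fun v =>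
    memLp_finsetSum _ fun j _ => (hZ (e j)).const_mul (v j)
  have hρ : MemLp (fun ω => Z b ω - ∑ j, a j * Z (e j) ω) 2 P := (hZ b).sub (hsum a)
  have hρe : hρ.toLp _ = (hZ b).toLp (Z b) - ∑ j, a j • (hZ (e j)).toLp (Z (e j)) := by
    rw [← toLp_sum_mul (fun j => hZ (e j)) a (hsum a) fun _ => rfl]
    exact MemLp.toLp_sub (hZ b) (hsum a)
  have hδ : MemLp (fun ω => U (fun j => Z (e j) ω) - ∑ j, w j * Z (e j) ω) 2 P :=
    hU2.sub (hsum w)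
  have hδe : hδ.toLp _ = hU2.toLp _ - ∑ j, w j • (hZ (e j)).toLp (Z (e j)) := by
    rw [← toLp_sum_mul (fun j => hZ (e j)) w (hsum w) fun _ => rfl]
    exact MemLp.toLp_sub hU2 (hsum w)
  have hρ0 : ∫ ω, (Z b ω - ∑ j, a j * Z (e j) ω) ∂P = 0 := by
    have hi := fun b => (hZ b).integrable one_le_two
    rw [integral_sub (hi b) ((hsum a).integrable one_le_two),
      integral_finsetSum _ fun j _ => (hi (e j)).const_mul (a j)]
    simp [integral_const_mul, hZ0]
  -- The residual is jointly Gaussian with the observations and uncorrelated with them, hence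
  -- independent of them.
  have hind : IndepFun (fun ω (j : ι) => Z (e j) ω)
      (fun ω (_ : Unit) => Z b ω - ∑ j, a j * Z (e j) ω) P := by
    refine HasGaussianLaw.indepFun_of_covariance_eval (X := fun j => Z (e j))
      (Y := fun _ ω => Z b ω - ∑ j, a j * Z (e j) ω) ?_ fun j _ => ?_
    · have := hG.map_fun (ContinuousLinearMap.prod
        (ContinuousLinearMap.pi fun j => ContinuousLinearMap.proj (e j))
        (ContinuousLinearMap.pi fun _ : Unit => ContinuousLinearMap.proj b
          - ∑ j, a j • ContinuousLinearMap.proj (R := ℝ) (φ := fun _ : β => ℝ) (e j)))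
      refine this.congr (Filter.Eventually.of_forall fun ω => ?_)
      ext <;> simp
    · rw [covariance_eq_sub (hZ (e j)) hρ, hρ0, mul_zero, sub_zero]
      have := ha j
      rw [← hρe, inner_toLp_toLp] at this
      exact this
  have hind' : IndepFun (fun ω => Z b ω - ∑ j, a j * Z (e j) ω)
      (fun ω => U (fun j => Z (e j) ω) - ∑ j, w j * Z (e j) ω) P :=
    (hind.comp (φ := fun z => U z - ∑ j, w j * z j) (ψ := fun y : Unit → ℝ => y ()) (by fun_prop)
      (measurable_pi_apply ())).symm
  -- The regression part of `Z b` is orthogonal to the error by the choice of `w`, the residual by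
  -- independence and zero mean.
  have hb : (hZ b).toLp (Z b) = hρ.toLp _ + ∑ j, a j • (hZ (e j)).toLp (Z (e j)) := by
    rw [hρe, sub_add_cancel]
  rw [hb, inner_add_left, sum_inner]
  simp only [real_inner_smul_left, hw, mul_zero, Finset.sum_const_zero, add_zero]
  rw [← hδe, inner_toLp_toLp]
  have := hind'.integral_mul_eq_mul_integral hρ.1 hδ.1
  rw [hρ0, zero_mul] at this
  exact this

end Gaussian

/-! ### Team decisions and block-diagonal gains. -/

section Team

open scoped RealInnerProductSpace

theorem dotProduct_mulVec_eq_sum_inner {β κ : Type*} [Fintype β] [Fintype κ] (A : Matrix β κ ℝ)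
    (x : β → ℝ) (u : κ → ℝ) : x ⬝ᵥ (A *ᵥ u) = ∑ b, ∑ c, A b c * ⟪x b, u c⟫ := by
  simp only [dotProduct, Matrix.mulVec, Finset.mul_sum, RCLike.inner_apply, conj_trivial]
  refine Finset.sum_congr rfl fun b _ => Finset.sum_congr rfl fun c _ => ?_
  ring

theorem quadForm_eq_gramCost {β κ : Type*} [Fintype β] [Fintype κ] (Q : Matrix β β ℝ)
    (S : Matrix β κ ℝ) (R : Matrix κ κ ℝ) (x : β → ℝ) (u : κ → ℝ) :
    quadForm Q S R x u = gramCost Q S R x u := by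
  have hS : u ⬝ᵥ (Sᵀ *ᵥ x) = x ⬝ᵥ (S *ᵥ u) := by
    rw [Matrix.mulVec_transpose, dotProduct_comm, Matrix.dotProduct_mulVec]
  rw [quadForm, Matrix.fromBlocks_mulVec, sumElim_dotProduct_sumElim, gramCost,
    ← dotProduct_mulVec_eq_sum_inner, ← dotProduct_mulVec_eq_sum_inner,
    ← dotProduct_mulVec_eq_sum_inner]
  simp only [Function.comp_def, Sum.elim_inl, Sum.elim_inr, dotProduct_add]
  rw [hS]
  ring

variable {N M : ℕ} {p m : Fin N → ℕ} (X : Matrix (BlockIdx p) (BlockIdx p) ℝ)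

theorem hasGaussianLaw_coord :
    HasGaussianLaw (fun (x : EuclideanSpace ℝ (BlockIdx p)) b => x b) (multivariateGaussian 0 X) :=
  IsGaussian.hasGaussianLaw_id.map_equiv (PiLp.continuousLinearEquiv 2 ℝ fun _ : BlockIdx p => ℝ)

theorem memLp_coord (b : BlockIdx p) :
    MemLp (fun x : EuclideanSpace ℝ (BlockIdx p) => x b) 2 (multivariateGaussian 0 X) :=
  ((hasGaussianLaw_coord X).eval b).memLp_two

theorem integral_coord (b : BlockIdx p) :
    ∫ x : EuclideanSpace ℝ (BlockIdx p), x b ∂(multivariateGaussian 0 X) = 0 := by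
  have := (EuclideanSpace.proj (𝕜 := ℝ) b : EuclideanSpace ℝ (BlockIdx p) →L[ℝ] ℝ).integral_comp_comm
    (φ := fun x => x) (μ := multivariateGaussian 0 X) IsGaussian.integrable_fun_id
  simpa using this

/-- The coordinates of `x ∼ 𝒩(0, X)` as square integrable random variables. -/
noncomputable def coordLp (b : BlockIdx p) :
    Lp ℝ 2 (multivariateGaussian (0 : EuclideanSpace ℝ (BlockIdx p)) X) :=
  (memLp_coord X b).toLp _

theorem stageCost_eq_gramCost (Q : Matrix (BlockIdx p) (BlockIdx p) ℝ)
    (S : Matrix (BlockIdx p) (BlockIdx m) ℝ) (R : Matrix (BlockIdx m) (BlockIdx m) ℝ)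
    (μ : (BlockIdx p → ℝ) → (BlockIdx m → ℝ)) :
    stageCost Q S R μ = fun x => gramCost Q S R (fun b => x b) fun c => μ (fun b => x b) c :=
  funext fun _ => quadForm_eq_gramCost Q S R _ _

theorem hasExpCost_of_memLp (Q : Matrix (BlockIdx p) (BlockIdx p) ℝ)
    (S : Matrix (BlockIdx p) (BlockIdx m) ℝ) (R : Matrix (BlockIdx m) (BlockIdx m) ℝ)
    {μ : (BlockIdx p → ℝ) → (BlockIdx m → ℝ)}
    (hμ : ∀ c, MemLp (fun x : EuclideanSpace ℝ (BlockIdx p) => μ (fun b => x b) c) 2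
      (multivariateGaussian 0 X)) :
    HasExpCost X Q S R μ := by
  rw [HasExpCost, stageCost_eq_gramCost]
  exact integrable_gramCost Q S R (memLp_coord X) hμ

theorem expCost_eq_gramCost (Q : Matrix (BlockIdx p) (BlockIdx p) ℝ)
    (S : Matrix (BlockIdx p) (BlockIdx m) ℝ) (R : Matrix (BlockIdx m) (BlockIdx m) ℝ)
    {μ : (BlockIdx p → ℝ) → (BlockIdx m → ℝ)}
    (hμ : ∀ c, MemLp (fun x : EuclideanSpace ℝ (BlockIdx p) => μ (fun b => x b) c) 2
      (multivariateGaussian 0 X)) :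
    expCost X Q S R μ = gramCost Q S R (coordLp X) fun c => (hμ c).toLp _ := by
  rw [expCost, stageCost_eq_gramCost]
  exact integral_gramCost Q S R (memLp_coord X) hμ

theorem IsTeamDecision.measurable {μ : (BlockIdx p → ℝ) → (BlockIdx m → ℝ)}
    (hμ : IsTeamDecision μ) : Measurable μ := by
  obtain ⟨f, hf, h⟩ := hμ
  refine measurable_pi_lambda _ fun ⟨i, a⟩ => ?_
  simp only [h]
  exact (measurable_pi_apply a).comp
    ((hf i).comp (measurable_pi_lambda _ fun b => measurable_pi_apply _))

theorem HasExpCost.memLp {Q : Matrix (BlockIdx p) (BlockIdx p) ℝ}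
    {S : Matrix (BlockIdx p) (BlockIdx m) ℝ} {R : Matrix (BlockIdx m) (BlockIdx m) ℝ}
    (hR : R.PosDef) {μ : (BlockIdx p → ℝ) → (BlockIdx m → ℝ)} (hμ : Measurable μ)
    (h : HasExpCost X Q S R μ) (c : BlockIdx m) :
    MemLp (fun x : EuclideanSpace ℝ (BlockIdx p) => μ (fun b => x b) c) 2
      (multivariateGaussian 0 X) := by
  rw [HasExpCost, stageCost_eq_gramCost] at h
  have hm : ∀ c, Measurable fun x : EuclideanSpace ℝ (BlockIdx p) => μ (fun b => x b) c :=
    fun c => (measurable_pi_apply c).comp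
      (hμ.comp (measurable_pi_lambda _ fun b => by fun_prop))
  exact memLp_two_of_integrable_gramCost (f := fun b (x : EuclideanSpace ℝ (BlockIdx p)) => x b)
    (u := fun c x => μ (fun b => x b) c) hR (memLp_coord X)
    (fun c => (hm c).aestronglyMeasurable) h c

theorem memLp_mulVec (K : Matrix (BlockIdx m) (BlockIdx p) ℝ) (c : BlockIdx m) :
    MemLp (fun x : EuclideanSpace ℝ (BlockIdx p) => (K *ᵥ fun b => x b) c) 2
      (multivariateGaussian 0 X) :=
  memLp_finsetSum _ fun b _ => (memLp_coord X b).const_mul (K c b)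

theorem expCost_mulVec (Q : Matrix (BlockIdx p) (BlockIdx p) ℝ)
    (S : Matrix (BlockIdx p) (BlockIdx m) ℝ) (R : Matrix (BlockIdx m) (BlockIdx m) ℝ)
    (K : Matrix (BlockIdx m) (BlockIdx p) ℝ) :
    expCost X Q S R (fun x => K *ᵥ x)
      = gramCost Q S R (coordLp X) fun c => ∑ b, K c b • coordLp X b := by
  rw [expCost_eq_gramCost X Q S R (μ := fun x => K *ᵥ x) (memLp_mulVec X K)]
  congr 1
  funext c
  exact toLp_sum_mul (memLp_coord X) (K c) (memLp_mulVec X K c) fun _ => rfl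

theorem blockDiagonal'_mulVec_mk (k : (i : Fin N) → Matrix (Fin (m i)) (Fin (p i)) ℝ)
    (x : BlockIdx p → ℝ) (i : Fin N) (a : Fin (m i)) :
    (Matrix.blockDiagonal' k *ᵥ x) ⟨i, a⟩ = (k i *ᵥ fun b => x ⟨i, b⟩) a := by
  simp only [Matrix.mulVec, dotProduct, Fintype.sum_sigma]
  rw [Finset.sum_eq_single i]
  · simp only [Matrix.blockDiagonal'_apply_eq]
  · intro i' _ hi'
    refine Finset.sum_eq_zero fun b _ => ?_
    rw [Matrix.blockDiagonal'_apply_ne _ _ _ hi'.symm, zero_mul]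
  · exact fun h => (h (Finset.mem_univ i)).elim

theorem isTeamDecision_blockDiagonal' (k : (i : Fin N) → Matrix (Fin (m i)) (Fin (p i)) ℝ) :
    IsTeamDecision fun x : BlockIdx p → ℝ => Matrix.blockDiagonal' k *ᵥ x :=
  ⟨fun i y => k i *ᵥ y, fun _ => (Continuous.matrix_mulVec continuous_const continuous_id).measurable,
    fun x i a => blockDiagonal'_mulVec_mk k x i a⟩

/-- The square integrable random vector `K x` for `K = diag(K₁, …, K_N)`, linearly in `K`. -/
noncomputable def gainLp : ((i : Fin N) → Matrix (Fin (m i)) (Fin (p i)) ℝ) →ₗ[ℝ]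
    (BlockIdx m → Lp ℝ 2 (multivariateGaussian (0 : EuclideanSpace ℝ (BlockIdx p)) X)) where
  toFun k c := ∑ b, Matrix.blockDiagonal' k c b • coordLp X b
  map_add' k k' := by
    funext c
    simp [Matrix.blockDiagonal'_add, add_smul, Finset.sum_add_distrib]
  map_smul' a k := by
    funext c
    simp [Matrix.blockDiagonal'_smul, mul_smul, Finset.smul_sum]

/-- Every team decision of finite expected cost is dominated by a linear one, simultaneously for all
costs which are convex in the decision. -/
theorem exists_gain_expCost_le {μ : (BlockIdx p → ℝ) → (BlockIdx m → ℝ)} (hμ : IsTeamDecision μ)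
    (hμ2 : ∀ c, MemLp (fun x : EuclideanSpace ℝ (BlockIdx p) => μ (fun b => x b) c) 2
      (multivariateGaussian 0 X)) :
    ∃ k : (i : Fin N) → Matrix (Fin (m i)) (Fin (p i)) ℝ,
      ∀ (Q : Matrix (BlockIdx p) (BlockIdx p) ℝ) (S : Matrix (BlockIdx p) (BlockIdx m) ℝ)
        (R : Matrix (BlockIdx m) (BlockIdx m) ℝ), R.PosSemidef →
        gramCost Q S R (coordLp X) (gainLp X k) ≤ expCost X Q S R μ := by
  obtain ⟨f, hf, h⟩ := hμ
  have hpred : ∀ (i : Fin N) (a : Fin (m i)), ∃ w : Fin (p i) → ℝ, ∀ b,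
      ⟪coordLp X b, (hμ2 ⟨i, a⟩).toLp _ - ∑ j, w j • coordLp X ⟨i, j⟩⟫ = 0 := fun i a => by
    have e : (fun x : EuclideanSpace ℝ (BlockIdx p) => μ (fun b => x b) ⟨i, a⟩)
        = fun x => f i (fun j => x ⟨i, j⟩) a := funext fun x => h _ i a
    have hm := hμ2 ⟨i, a⟩
    simp only [e] at hm ⊢
    exact exists_linear_predictor (Z := fun b (x : EuclideanSpace ℝ (BlockIdx p)) => x b)
      (hasGaussianLaw_coord X) (memLp_coord X) (integral_coord X) (fun j => ⟨i, j⟩)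
      (U := fun y => f i y a) ((measurable_pi_apply a).comp (hf i)) hm
  choose w hw using hpred
  refine ⟨fun i => Matrix.of (w i), fun Q S R hR => ?_⟩
  rw [expCost_eq_gramCost X Q S R hμ2]
  refine gramCost_le_of_orthogonal hR (fun b c => ?_) fun c =>
    Submodule.sum_mem _ fun b _ => Submodule.smul_mem _ _ (Submodule.subset_span ⟨b, rfl⟩)
  obtain ⟨i, a⟩ := c
  have : gainLp X (fun i => Matrix.of (w i)) ⟨i, a⟩ = ∑ j, w i a j • coordLp X ⟨i, j⟩ := by
    change ∑ b, Matrix.blockDiagonal' _ _ b • coordLp X b = _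
    rw [Fintype.sum_sigma, Finset.sum_eq_single i]
    · simp only [Matrix.blockDiagonal'_apply_eq, Matrix.of_apply]
    · intro i' _ hi'
      refine Finset.sum_eq_zero fun b _ => ?_
      rw [Matrix.blockDiagonal'_apply_ne _ _ _ hi'.symm, zero_smul]
    · exact fun h => (h (Finset.mem_univ i)).elim
  rw [this]
  exact hw i a b

end Team

end TeamLQG

theorem theorem2 {N M : ℕ} {p m : Fin N → ℕ} (D : TeamLQG.Problem M p m)
    (X : Matrix (TeamLQG.BlockIdx p) (TeamLQG.BlockIdx p) ℝ) (hX : X.PosSemidef)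
    (h₀ : (Matrix.fromBlocks D.Q₀ D.S₀ D.S₀ᵀ D.R₀).PosSemidef)
    (hR₀ : D.R₀.PosDef)
    (hj : ∀ j, (Matrix.fromBlocks (D.Q j) (D.S j) (D.S j)ᵀ (D.R j)).IsSymm)
    (hRj : ∀ j, (D.R j).PosSemidef)
    (hfeas : ∃ μ : (TeamLQG.BlockIdx p → ℝ) → (TeamLQG.BlockIdx m → ℝ),
      TeamLQG.IsFeasible D X μ) :
    ∃ K ∈ TeamLQG.teamGains m p, TeamLQG.IsOptimal D X (fun x => K *ᵥ x) := by
  open TeamLQG in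
  have hdom : ∀ μ, IsFeasible D X μ → ∃ k : (i : Fin N) → Matrix (Fin (m i)) (Fin (p i)) ℝ,
      (∀ j, gramCost (D.Q j) (D.S j) (D.R j) (coordLp X) (gainLp X k) ≤ D.γ j) ∧
        gramCost D.Q₀ D.S₀ D.R₀ (coordLp X) (gainLp X k) ≤ expCost X D.Q₀ D.S₀ D.R₀ μ := by
    intro μ hμ
    obtain ⟨k, hk⟩ := exists_gain_expCost_le X hμ.team
      (hμ.finite_cost.memLp X hR₀ hμ.team.measurable)
    exact ⟨k, fun j => (hk _ _ _ (hRj j)).trans (hμ.constraint_le j), hk _ _ _ hR₀.posSemidef⟩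
  obtain ⟨μ, hμ⟩ := hfeas
  obtain ⟨k₀, hk₀, -⟩ := hdom μ hμ
  -- The minimization runs over the random vectors `K x`, not over `K`: for singular `X` a nonzero
  -- gain may give `K x = 0` almost surely, so coercivity in `K` can fail.
  obtain ⟨_, ⟨k, rfl⟩, hk, hmin⟩ := TeamLQG.exists_isMinOn_gramCost hR₀ D.Q₀ D.S₀ D.Q D.S D.R D.γ
    (TeamLQG.coordLp X) (LinearMap.range (TeamLQG.gainLp X)) ⟨_, ⟨k₀, rfl⟩, hk₀⟩
  refine ⟨Matrix.blockDiagonal' k, ⟨k, rfl⟩, ⟨TeamLQG.isTeamDecision_blockDiagonal' k,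
    TeamLQG.hasExpCost_of_memLp X _ _ _ (TeamLQG.memLp_mulVec X _),
    fun j => TeamLQG.hasExpCost_of_memLp X _ _ _ (TeamLQG.memLp_mulVec X _), fun j => ?_⟩,
    fun ν hν => ?_⟩
  · rw [TeamLQG.expCost_mulVec]
    exact hk j
  · obtain ⟨k', hk', hle⟩ := hdom ν hν
    rw [TeamLQG.expCost_mulVec]
    exact (hmin _ ⟨k', rfl⟩ hk').trans hle
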